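/- Let $r\ge1$, $\mathbf m=(m_1,\dots,m_r)$ with integers $m_j\ge1$, $m=m_1+\dots+m_r$, $\mathbf f=(f_1,\dots,f_r)\in\mathbb C^r$ with no $f_j$ in $-\mathbb N_0=\{0,-1,-2,\dots\}$, $a,b\in\mathbb C$, and $q\in\{0,\dots,m-1\}$. Write $(z)_n=z(z+1)\cdots(z+n-1)$, $(\mathbf f)_{\mathbf m}=\prod_j(f_j)_{m_j}$, define $\sigma_j$ by $\prod_{i}(f_i+x)_{m_i}=\sum_{j=0}^m\sigma_jx^j$, and put $C_{k,r}=\frac1{(\mathbf f)_{\mathbf m}}\sum_{j=k}^m\sigma_jS_j^{(k)}$ with $S_j^{(k)}$ the Stirling numbers of the second kind. For $|x|<1$ the function ${}_{p+1}F_p$ is the sum of the hypergeometric series, and on $\mathbb C\setminus[1,\infty)$ it is its analytic continuation; ${}_3F_2$ without argument means the terminating series at $1$. Assume $a+m-q\notin-\mathbb N_0$, $a-b\notin\{q+1-m,\dots,q\}$, and $f_j-a\notin\{m-q-m_j,m-q-m_j+1,\dots,0\}$ for every $j\in\{1,\dots,r\}$ with $m-q-m_j\le0$. Set $$\hat Q^0_m(-l)=\sum_{k=0}^{l}\frac{(-1)^k(-l)_k(a)_k(b)_kC_{k,r}}{(-q)_k(a-b-q)_k}\,{}_3F_2\!\left(\begin{matrix}k-m,\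 k-l,\ -b-q\\ k-q,\ a-b-q+k\end{matrix}\right),\qquad 0\le l\le q$$ (the inner series being the sum over $0\le n\le l-k$; thus $\hat Q^0_m(0)=1$), and $$\hat R_{m-q-1}(t)=\frac{(b)_{q+1}}{(b-a)_{q+1}}\sum_{k=0}^{q}\frac{(-m+k)_{q-k+1}(a)_kC_{k,r}}{(q-k+1)!}\,{}_3F_2\!\left(\begin{matrix}1-m+q,\ t+q+1,\ 1-b-k\\ a-b+1,\ 2-k+q\end{matrix}\right)$$ $$+\sum_{k=q+1}^{m}\frac{(-1)^k(a)_k(b)_kC_{k,r}(t+q+1)_{k-q-1}}{(a-b-q)_k(k-q-1)!}\,{}_3F_2\!\left(\begin{matrix}-m+k,\ t+k,\ -b-q\\ a-b-q+k,\ k-q\end{matrix}\right).$$ Then: (1) $\hat R_{m-q-1}$ is a polynomial in $t$ of degree at most $m-q-1$, and $$\hat R_{m-q-1}(-q-1)=\frac{(b)_{q+1}}{(b-a)_{q+1}}\sum_{k=0}^{q+1}\frac{(-m+k)_{q+1-k}(a)_kC_{k,r}}{(q+1-k)!}.$$ (2) Let $\boldsymbol\gamma=(\gamma_1,\dots,\gamma_s)$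 be the zeros of $\hat R_{m-q-1}$ with multiplicity ($s=\deg\hat R_{m-q-1}$, which is $m-q-1$ unless the degree drops; no zeros are listed if $\hat R_{m-q-1}\equiv0$), and suppose that no $\gamma_i+q+1$ lies in $-\mathbb N_0$, so that the function on the right below is defined. Then for all $x\in\mathbb C\setminus[1,\infty)$, with the principal branch of the power, $$(1-x)^{b+q}\,{}_{r+2}F_{r+1}\!\left(\begin{matrix}a,\ b,\ \mathbf f+\mathbf m\\ a+m-q,\ \mathbf f\end{matrix}\,\Big|\,x\right)=\sum_{j=0}^{q}\frac{(-q)_j(a-b-q)_j}{(a+m-q)_j\,j!}\hat Q^0_m(-j)x^j$$ $$+\,x^{q+1}\frac{\hat R_{m-q-1}(-q-1)\,(b-a)_{q+1}}{(a+m-q)_{q+1}}\;{}_{s+2}F_{s+1}\!\left(\begin{matrix}1,\ a-b+1,\ \boldsymbol\gamma+q+2\\ a+m+1,\ \boldsymbol\gamma+q+1\end{matrix}\,\Big|\,x\right).$$ When $s=m-q-1$ the last function is ${}_{m-q+1}F_{m-q}$. -/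

import Mathlib

open Polynomial

noncomputable section

namespace MillerParis

/-- The Pochhammer symbol (rising factorial) `(a)_n = a (a+1) ⋯ (a+n-1)`. -/
def poch (a : ℂ) (n : ℕ) : ℂ := (ascPochhammer ℂ n).eval a

/-- The `n`-th Maclaurin coefficient of the generalized hypergeometric function with top
parameters `as` and bottom parameters `bs`. -/
def hypCoeff (as bs : Multiset ℂ) (n : ℕ) : ℂ :=
  (as.map fun a => poch a n).prod / ((bs.map fun b => poch b n).prod * (n.factorial : ℂ))

/-- The cut plane `ℂ ∖ [1, ∞)`. -/
def cutPlane : Set ℂ := {x : ℂ | ¬ (1 ≤ x.re ∧ x.im = 0)}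

/-- `F` is the holomorphic continuation to `ℂ ∖ [1, ∞)` of the hypergeometric series
with top parameters `as` and bottom parameters `bs`. -/
structure IsHypContinuation (as bs : Multiset ℂ) (F : ℂ → ℂ) : Prop where
  differentiableOn : DifferentiableOn ℂ F cutPlane
  hasSum : ∀ x : ℂ, ‖x‖ < 1 → HasSum (fun n : ℕ => hypCoeff as bs n * x ^ n) (F x)

/-- The generalized hypergeometric function `_{p+1}F_p` on `ℂ ∖ [1, ∞)`: the holomorphic
continuation of its series. It is unique on `ℂ ∖ [1, ∞)`, a connected open set containing the
unit disk, and it exists when there is one top parameter more than there are bottom ones and no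
bottom parameter is a nonpositive integer. The values outside the cut plane are irrelevant. -/
def hypF (as bs : Multiset ℂ) : ℂ → ℂ := Classical.epsilon (IsHypContinuation as bs)

/-- The terminating series `₃F₂(-N, u, v; c, d; 1)`, as the finite sum over `0 ≤ n ≤ N`. -/
def terminatingF32 (N : ℕ) (u v c d : ℂ) : ℂ :=
  ∑ n ∈ Finset.range (N + 1),
    poch (-(N : ℂ)) n * poch u n * poch v n / (poch c n * poch d n * (n.factorial : ℂ))

/-- The polynomial `(t + s)_n` in the variable `t`. -/
def pochPoly (s : ℂ) (n : ℕ) : ℂ[X] := (ascPochhammer ℂ n).comp (X + C s)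

/-- The terminating series `₃F₂(-N, t + s, v; c, d; 1)`, as a polynomial in `t`. -/
def terminatingF32Poly (N : ℕ) (s v c d : ℂ) : ℂ[X] :=
  ∑ n ∈ Finset.range (N + 1),
    C (poch (-(N : ℂ)) n * poch v n / (poch c n * poch d n * (n.factorial : ℂ))) * pochPoly s n

/-- The number `(f)_m = (f_1)_{m_1} ⋯ (f_r)_{m_r}`. -/
def pochVec {r : ℕ} (f : Fin r → ℂ) (m : Fin r → ℕ) : ℂ := ∏ j, poch (f j) (m j)

/-- The number `σ_j`, the coefficient of `x ^ j` in `(f_1 + x)_{m_1} ⋯ (f_r + x)_{m_r}`. -/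
def sigmaCoeff {r : ℕ} (f : Fin r → ℂ) (m : Fin r → ℕ) (j : ℕ) : ℂ :=
  (∏ i, pochPoly (f i) (m i)).coeff j

/-- The number `C_{k,r} = (1/(f)_m) ∑_{j=k}^m σ_j S_j^{(k)}`, with `S_j^{(k)}` the Stirling numbers
of the second kind and `m = m_1 + ⋯ + m_r`. -/
def coeffC {r : ℕ} (f : Fin r → ℂ) (m : Fin r → ℕ) (k : ℕ) : ℂ :=
  1 / pochVec f m *
    ∑ j ∈ Finset.Icc k (∑ i, m i), sigmaCoeff f m j * (Nat.stirlingSecond j k : ℂ)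

/-- The value `Q̂⁰_m(-l)` for `0 ≤ l ≤ q` (for `l = 0` the sum is `C_{0,r} = 1`). The inner
`₃F₂(k - m, k - l, -b - q; k - q, a - b - q + k; 1)` is terminated by its
parameter `k - l = -(l - k)`, before its bottom parameter `k - q` produces a zero. -/
def hatQ {r : ℕ} (a b : ℂ) (f : Fin r → ℂ) (m : Fin r → ℕ) (q l : ℕ) : ℂ :=
  ∑ k ∈ Finset.range (l + 1),
    (-1) ^ k * poch (-(l : ℂ)) k * poch a k * poch b k * coeffC f m k /
        (poch (-(q : ℂ)) k * poch (a - b - q) k) *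
      terminatingF32 (l - k) ((k : ℂ) - (∑ i, m i : ℕ)) (-b - q) ((k : ℂ) - q) (a - b - q + k)

/-- The reduced polynomial `R̂_{m-q-1}(t)`, where `m = m_1 + ⋯ + m_r`. -/
def hatR {r : ℕ} (a b : ℂ) (f : Fin r → ℂ) (m : Fin r → ℕ) (q : ℕ) : ℂ[X] :=
  C (poch b (q + 1) / poch (b - a) (q + 1)) *
      ∑ k ∈ Finset.range (q + 1),
        C (poch (-((∑ i, m i : ℕ) : ℂ) + k) (q - k + 1) * poch a k * coeffC f m k /
            ((q - k + 1).factorial : ℂ)) *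
          terminatingF32Poly ((∑ i, m i) - q - 1) ((q : ℂ) + 1) (1 - b - k)
            (a - b + 1) (2 - (k : ℂ) + q)
    + ∑ k ∈ Finset.Icc (q + 1) (∑ i, m i),
        C ((-1) ^ k * poch a k * poch b k * coeffC f m k /
            (poch (a - b - q) k * ((k - q - 1).factorial : ℂ))) *
          pochPoly ((q : ℂ) + 1) (k - q - 1) *
          terminatingF32Poly ((∑ i, m i) - k) (k : ℂ) (-b - q) (a - b - q + k) ((k : ℂ) - q)

end MillerParis

end

/-!
On both sides stand holomorphic functions on `ℂ ∖ [1, ∞)`, so the transformation is an identity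
between the Maclaurin coefficients.

The factor `(𝐟 + 𝐦)_n / (𝐟)_n` is a polynomial in `n`, and `C_{k,r}` are its coefficients in the
basis of falling factorials `n (n - 1) ⋯ (n - k + 1)` (`sum_coeffC_mul_descFactorial`). For one
falling factorial, the coefficients of `(1 - x) ^ (b + q)` times the series are terminating `₃F₂`
sums. A two-term relation of Thomae type, `sum_eq_scaledF32`, turns them into the `₃F₂` sums from
which `hatQ` and `hatR` are built. It is stated without denominators, as a polynomial identity, so
that it holds at the nonpositive integral bottom parameters `k - q` too, and it follows from the
Chu-Vandermonde and Pfaff-Saalschütz summations. For the coefficient of `x ^ N` with `N ≤ q`, no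
factor vanishes and the relation gives `hatQ` (`productCoeff_of_le`). For `N = q + 1 + n`, the terms
with `k ≤ q` lose their first `q - k + 1` summands, which gives the two sums of `hatR`, at the point
`-q - 1 - n` (`productCoeff_add`). Dividing by the value at `-q - 1` and factoring `hatR` over its
roots `γ` gives the quotients `(γ + q + 2)_n / (γ + q + 1)_n` (`eval_mul_prod_roots`).

It remains to see that the functions `hypF` are genuine, that is, that the series continue to the
cut plane. The coefficients of both are products of quotients `(a)_n / (c)_n` and a polynomial in
`n`, starting from the geometric series. A polynomial factor acts by the operator `x d/dx`; a factor
`(a)_n / (c)_n` acts by Euler's integral `∫ t ^ (a - 1) (1 - t) ^ (c - a - 1) F (t x) dt` when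
`0 < re a < re c`, and contiguity and index shifts remove this restriction
(`Continuable.poch_div_mul`).
-/

noncomputable section

namespace MillerParis

/-! ### Rising factorials -/

theorem poch_zero (a : ℂ) : poch a 0 = 1 := by simp [poch]

theorem poch_succ (a : ℂ) (n : ℕ) : poch a (n + 1) = poch a n * (a + n) := by
  simp [poch, ascPochhammer_succ_eval]

theorem poch_add (a : ℂ) (m n : ℕ) : poch a (m + n) = poch a m * poch (a + m) n := by
  induction n with
  | zero => simp [poch_zero]
  | succ n ih =>
    rw [← add_assoc, poch_succ, ih, poch_succ]
    push_cast
    ring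

theorem poch_one (a : ℂ) : poch a 1 = a := by
  simp [poch]

theorem poch_succ_left (a : ℂ) (n : ℕ) : poch a (n + 1) = a * poch (a + 1) n := by
  rw [add_comm n 1, poch_add, poch_one, Nat.cast_one]

theorem poch_split (a : ℂ) {i n : ℕ} (h : i ≤ n) :
    poch a n = poch a i * poch (a + i) (n - i) := by
  rw [← poch_add, Nat.add_sub_cancel' h]

theorem poch_ne_zero {a : ℂ} {n : ℕ} (h : ∀ i < n, a + i ≠ 0) : poch a n ≠ 0 := by
  induction n with
  | zero => simp [poch_zero]
  | succ n ih =>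
    rw [poch_succ]
    exact mul_ne_zero (ih fun i hi => h i (hi.trans n.lt_succ_self)) (h n n.lt_succ_self)

theorem poch_ne_zero_of_forall_ne_neg {c : ℂ} (hc : ∀ k : ℕ, c ≠ -(k : ℂ)) (n : ℕ) :
    poch c n ≠ 0 :=
  poch_ne_zero fun i _ h => hc i (eq_neg_of_add_eq_zero_left h)

theorem poch_one_left (n : ℕ) : poch 1 n = (n.factorial : ℂ) := by
  simp [poch]

theorem poch_natCast_add_one (p n : ℕ) :
    poch ((p : ℂ) + 1) n = ((p + n).factorial : ℂ) / (p.factorial : ℂ) := by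
  have h := poch_add 1 p n
  rw [poch_one_left, poch_one_left] at h
  rw [eq_div_iff (by exact_mod_cast p.factorial_ne_zero), h, add_comm (p : ℂ) 1, mul_comm]

/-- Reversing the factors of a rising factorial. -/
theorem poch_neg (a : ℂ) (n : ℕ) : poch (-a) n = (-1) ^ n * poch (a - n + 1) n := by
  induction n with
  | zero => simp [poch_zero]
  | succ n ih =>
    rw [poch_succ, ih, poch_succ_left,
      show a - ((n + 1 : ℕ) : ℂ) + 1 + 1 = a - n + 1 by push_cast; ring]
    push_cast
    ring

theorem poch_neg_natCast (j i : ℕ) :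
    poch (-(j : ℂ)) i = (-1) ^ i * ((j.choose i : ℂ) * (i.factorial : ℂ)) := by
  induction i with
  | zero => simp [poch_zero]
  | succ i ih =>
    rw [poch_succ, ih, Nat.factorial_succ]
    have h : ((j.choose (i + 1) : ℂ)) * ((i : ℂ) + 1) = (j.choose i : ℂ) * ((j : ℂ) - i) := by
      rcases le_or_gt i j with hij | hij
      · have := Nat.choose_succ_right_eq j i
        rw [← Nat.cast_sub hij]
        exact_mod_cast this
      · simp [Nat.choose_eq_zero_of_lt hij, Nat.choose_eq_zero_of_lt (hij.trans i.lt_succ_self)]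
    push_cast
    linear_combination (-(-1) ^ (i + 1) * (i.factorial : ℂ)) * h

theorem poch_neg_natCast_eq_zero {j i : ℕ} (h : j < i) : poch (-(j : ℂ)) i = 0 := by
  rw [poch_neg_natCast, Nat.choose_eq_zero_of_lt h]
  simp

theorem cast_choose_eq_div {j i : ℕ} (h : i ≤ j) :
    (j.choose i : ℂ) = (j.factorial : ℂ) / ((i.factorial : ℂ) * ((j - i).factorial : ℂ)) :=
  Nat.cast_choose ℂ h

/-! ### Summation formulas and a two-term relation for terminating `₃F₂` series -/

/-- The Chu-Vandermonde identity for rising factorials. -/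
theorem poch_vandermonde (x y : ℂ) (n : ℕ) :
    poch (x + y) n =
      ∑ i ∈ Finset.range (n + 1), (n.choose i : ℂ) * poch x i * poch y (n - i) := by
  rw [← Finset.Nat.sum_antidiagonal_eq_sum_range_succ
    (fun i j => (n.choose i : ℂ) * poch x i * poch y j)]
  induction n with
  | zero => simp [poch_zero]
  | succ n ih =>
    have h := Finset.sum_antidiagonal_choose_succ_mul (R := ℂ) (fun i j => poch x i * poch y j) n
    simp only [← mul_assoc] at h
    rw [h, poch_succ, ih, Finset.sum_mul, ← Finset.sum_add_distrib]
    refine Finset.sum_congr rfl fun p hp => ?_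
    have hp' : (p.1 : ℂ) + p.2 = n := by
      exact_mod_cast Finset.HasAntidiagonal.mem_antidiagonal.mp hp
    have hc : n.choose p.2 = n.choose p.1 := by
      rw [← Finset.HasAntidiagonal.mem_antidiagonal.mp hp, Nat.choose_symm_add]
    rw [poch_succ, poch_succ, hc, ← hp']
    ring

/-- The Pfaff-Saalschütz identity, with denominators cleared. -/
theorem poch_saalschuetz (A B D : ℂ) (n : ℕ) :
    ∑ i ∈ Finset.range (n + 1), (n.choose i : ℂ) * poch (D - B) (n - i) * poch A i * poch B i *
      poch (D + A + i) (n - i) = poch D n * poch (A - B + D) n := by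
  induction n generalizing D with
  | zero => simp [poch_zero]
  | succ n ih =>
    -- The summand for `n + 1` minus `D (A - B + D)` times the summand for `n` and `D + 1` is a
    -- difference in the summation index (creative telescoping).
    have key : ∀ k ≤ n, ∑ i ∈ Finset.range (k + 1),
        (((n + 1).choose i : ℂ) * poch (D - B) (n + 1 - i) * poch A i * poch B i *
            poch (D + A + i) (n + 1 - i) -
          D * (A - B + D) * ((n.choose i : ℂ) * poch (D + 1 - B) (n - i) * poch A i * poch B i *
            poch (D + 1 + A + i) (n - i))) =
        -((n.choose k : ℂ) * poch A (k + 1) * poch B (k + 1) * poch (D + 1 - B) (n - k) *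
          poch (D + 1 + A + k) (n - k)) := by
      intro k hk
      induction k with
      | zero =>
        simp only [zero_add, Finset.sum_range_one, Nat.sub_zero, poch_one, poch_zero,
          Nat.choose_zero_right, Nat.cast_one, Nat.cast_zero, add_zero]
        rw [poch_succ_left, poch_succ_left (D + A), show D - B + 1 = D + 1 - B by ring,
          show D + A + 1 = D + 1 + A by ring]
        ring
      | succ k ihk =>
        rw [Finset.sum_range_succ, ihk (by omega)]
        obtain ⟨p, rfl⟩ : ∃ p, n = k + 1 + p := ⟨n - (k + 1), by omega⟩
        have e1 : k + 1 + p + 1 - (k + 1) = p + 1 := by omega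
        have e2 : k + 1 + p - k = p + 1 := by omega
        have e3 : k + 1 + p - (k + 1) = p := by omega
        have hc : ((k + 1 + p).choose (k + 1) : ℂ) * ((k : ℂ) + 1) =
            ((k + 1 + p).choose k : ℂ) * ((p : ℂ) + 1) := by
          have := Nat.choose_succ_right_eq (k + 1 + p) k
          rw [e2] at this
          exact_mod_cast this
        rw [e1, e2, e3, Nat.choose_succ_succ (k + 1 + p) k, poch_succ A (k + 1),
          poch_succ B (k + 1), poch_succ_left (D - B), poch_succ (D + 1 - B),
          poch_succ_left (D + A + _), poch_succ_left (D + 1 + A + _),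
          show D - B + 1 = D + 1 - B by ring]
        push_cast
        rw [show D + A + ((k : ℂ) + 1) + 1 = D + 1 + A + (k + 1) by ring,
          show D + 1 + A + (k : ℂ) + 1 = D + 1 + A + (k + 1) by ring]
        linear_combination (D + A + k + 1) * poch A (k + 1) * poch B (k + 1) *
          poch (D + 1 - B) p * poch (D + 1 + A + (k + 1)) p * hc
    have h := key n le_rfl
    rw [Finset.sum_sub_distrib, ← Finset.mul_sum, ih (D + 1)] at h
    rw [Finset.sum_range_succ]
    simp only [Nat.choose_self, Nat.sub_self, poch_zero, Nat.cast_one, mul_one, one_mul] at h ⊢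
    rw [poch_succ_left D, poch_succ_left (A - B + D),
      show A - B + D + 1 = A - B + (D + 1) by ring]
    linear_combination h

/-- The polynomial `(d)_j (e)_j ₃F₂(-j, u, v; d, e; 1)` in the parameters, which makes sense
without any restriction on `d` and `e`. -/
def scaledF32 (j : ℕ) (u v d e : ℂ) : ℂ :=
  ∑ i ∈ Finset.range (j + 1), (-1) ^ i * (j.choose i : ℂ) * poch u i * poch v i *
    poch (d + i) (j - i) * poch (e + i) (j - i)

/-- A two-term relation between terminating `₃F₂` series, with denominators cleared. -/
theorem sum_eq_scaledF32 (A B G d : ℂ) (j : ℕ) :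
    ∑ i ∈ Finset.range (j + 1), (j.choose i : ℂ) * poch (d - B) (j - i) * poch A i * poch B i *
      poch (G + i) (j - i) = scaledF32 j (d + A - G) (d - B) d (A - B + d) := by
  -- Expand `(G + i)_{j - i}` in the `(d + A - G)_l`; each coefficient is a Saalschützian sum.
  have hexp : ∀ i ≤ j, poch (G + i) (j - i) = ∑ l ∈ Finset.range (j - i + 1),
      ((j - i).choose l : ℂ) * ((-1) ^ l * poch (d + A - G) l) *
        poch (d + A + i + l) (j - i - l) := by
    intro i hi
    have h1 : poch (G + i) (j - i) = (-1) ^ (j - i) *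
        poch ((d + A - G) + (1 - j - d - A)) (j - i) := by
      have := poch_neg (-(G + i)) (j - i)
      rw [neg_neg] at this
      rw [this]
      congr 2
      rw [Nat.cast_sub hi]
      ring
    rw [h1, poch_vandermonde, Finset.mul_sum]
    refine Finset.sum_congr rfl fun l hl => ?_
    have hl' : l ≤ j - i := by simpa [Nat.lt_succ_iff] using hl
    have h2 : poch (1 - j - d - A) (j - i - l) = (-1) ^ (j - i - l) *
        poch (d + A + i + l) (j - i - l) := by
      have := poch_neg (-(1 - j - d - A)) (j - i - l)
      rw [neg_neg] at this
      rw [this]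
      congr 2
      rw [Nat.cast_sub hl', Nat.cast_sub hi]
      ring
    have h3 : (-1 : ℂ) ^ (j - i) * (-1) ^ (j - i - l) = (-1) ^ l := by
      obtain ⟨s, hs⟩ : ∃ s, j - i = l + s := ⟨j - i - l, by omega⟩
      rw [hs, Nat.add_sub_cancel_left, pow_add, mul_assoc, ← mul_pow]
      simp
    rw [h2]
    linear_combination ((j - i).choose l : ℂ) * poch (d + A - G) l *
      poch (d + A + i + l) (j - i - l) * h3
  have hL : ∀ i ∈ Finset.range (j + 1), (j.choose i : ℂ) * poch (d - B) (j - i) * poch A i *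
      poch B i * poch (G + i) (j - i) = ∑ l ∈ Finset.range (j + 1 - i),
        (j.choose i : ℂ) * poch (d - B) (j - i) * poch A i * poch B i *
        (((j - i).choose l : ℂ) * ((-1) ^ l * poch (d + A - G) l) *
          poch (d + A + i + l) (j - i - l)) := by
    intro i hi
    have hi' : i ≤ j := by simpa [Nat.lt_succ_iff] using hi
    rw [hexp i hi', Finset.mul_sum, Nat.sub_add_comm hi']
  rw [Finset.sum_congr rfl hL, Finset.sum_comm' (t' := Finset.range (j + 1))
    (s' := fun l => Finset.range (j - l + 1))]
  · rw [scaledF32]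
    refine Finset.sum_congr rfl fun l hl => ?_
    have hl' : l ≤ j := by simpa [Nat.lt_succ_iff] using hl
    have hS := poch_saalschuetz A B (d + l) (j - l)
    rw [show A - B + d + (l : ℂ) = A - B + (d + l) by ring, mul_assoc, ← hS, Finset.mul_sum]
    refine Finset.sum_congr rfl fun i hi => ?_
    have hi' : i ≤ j - l := by simpa [Nat.lt_succ_iff] using hi
    have hc : (j.choose i : ℂ) * ((j - i).choose l : ℂ) =
        (j.choose l : ℂ) * ((j - l).choose i : ℂ) := by
      have h1 := Nat.choose_mul (n := j) (k := i + l) (s := i) (by omega)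
      have h2 := Nat.choose_mul (n := j) (k := i + l) (s := l) (by omega)
      rw [Nat.add_sub_cancel_left] at h1
      rw [Nat.add_sub_cancel] at h2
      rw [Nat.choose_symm_add] at h1
      exact_mod_cast h1.symm.trans h2
    rw [poch_split (d - B) (show l ≤ j - i by omega), show j - i - l = j - l - i by omega,
      show d - B + (l : ℂ) = d + l - B by ring, show d + A + (i : ℂ) + l = d + l + A + i by ring]
    linear_combination (-1) ^ l * poch (d + A - G) l * poch (d - B) l *
      poch (d + l - B) (j - l - i) * poch A i * poch B i *
      poch (d + l + A + i) (j - l - i) * hc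
  · intro i l
    simp only [Finset.mem_range]
    omega

/-- If `u` kills the terms with a zero denominator, the terminating `₃F₂` times `(d)_j (e)_j` is
the polynomial `scaledF32`. -/
theorem scaledF32_eq (j : ℕ) (u v d e : ℂ)
    (h : ∀ i ≤ j, poch u i ≠ 0 → poch d i ≠ 0 ∧ poch e i ≠ 0) :
    scaledF32 j u v d e = poch d j * poch e j * terminatingF32 j u v d e := by
  rw [scaledF32, terminatingF32, Finset.mul_sum]
  refine Finset.sum_congr rfl fun i hi => ?_
  have hi' : i ≤ j := by simpa [Nat.lt_succ_iff] using hi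
  by_cases hu : poch u i = 0
  · simp [hu]
  obtain ⟨hd, he⟩ := h i hi' hu
  have hf : (i.factorial : ℂ) ≠ 0 := by exact_mod_cast i.factorial_ne_zero
  rw [poch_neg_natCast, poch_split d hi', poch_split e hi']
  field_simp

/-! ### Falling factorial expansion of the parameter polynomial, and the Cauchy product -/

theorem eval_pochPoly (s t : ℂ) (n : ℕ) : (pochPoly s n).eval t = poch (t + s) n := by
  simp [pochPoly, poch]

theorem natDegree_pochPoly (s : ℂ) (n : ℕ) : (pochPoly s n).natDegree = n := by
  rw [pochPoly, natDegree_comp, ascPochhammer_natDegree, natDegree_X_add_C, mul_one]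

theorem pow_eq_sum_stirlingSecond (n j : ℕ) :
    n ^ j = ∑ k ∈ Finset.range (j + 1), Nat.stirlingSecond j k * n.descFactorial k := by
  induction j with
  | zero => simp
  | succ j ih =>
    have hmul : ∀ k, n.descFactorial k * n = n.descFactorial (k + 1) + k * n.descFactorial k := by
      intro k
      rw [Nat.descFactorial_succ]
      rcases le_or_gt k n with h | h
      · rw [← add_mul, Nat.sub_add_cancel h, mul_comm]
      · simp [Nat.descFactorial_of_lt h]
    have hS : ∀ k d, Nat.stirlingSecond (j + 1) (k + 1) * d =
        Nat.stirlingSecond j k * d + Nat.stirlingSecond j (k + 1) * ((k + 1) * d) := by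
      intro k d
      rw [Nat.stirlingSecond_succ_succ]
      ring
    rw [pow_succ, ih, Finset.sum_mul, Finset.sum_range_succ' _ (j + 1)]
    simp only [hS, Nat.stirlingSecond_succ_zero, zero_mul, add_zero, mul_assoc, hmul, mul_add,
      Finset.sum_add_distrib]
    congr 1
    rw [Finset.sum_range_succ', Finset.sum_range_succ _ j]
    simp [Nat.stirlingSecond_eq_zero_of_lt (Nat.lt_succ_self j)]

/-- The polynomial whose values at the integers `n` are `(𝐟 + 𝐦)_n (𝐟)_𝐦 / (𝐟)_n`. -/
def paramPoly {r : ℕ} (f : Fin r → ℂ) (m : Fin r → ℕ) : ℂ[X] := ∏ i, pochPoly (f i) (m i)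

theorem eval_paramPoly {r : ℕ} (f : Fin r → ℂ) (m : Fin r → ℕ) (x : ℂ) :
    (paramPoly f m).eval x = ∏ i, poch (x + f i) (m i) := by
  simp [paramPoly, eval_prod, eval_pochPoly]

/-- In the basis of falling factorials, the values of `paramPoly` have the coefficients
`C_{k,r}`. -/
theorem sum_coeffC_mul_descFactorial {r : ℕ} (f : Fin r → ℂ) (m : Fin r → ℕ) (n : ℕ) :
    ∑ k ∈ Finset.range ((∑ i, m i) + 1), coeffC f m k * (n.descFactorial k : ℂ) =
      (paramPoly f m).eval (n : ℂ) / pochVec f m := by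
  have hdeg : (paramPoly f m).natDegree < (∑ i, m i) + 1 := by
    refine Nat.lt_succ_of_le ((natDegree_prod_le _ _).trans ?_)
    simp [natDegree_pochPoly]
  rw [eval_eq_sum_range' hdeg, Finset.sum_div]
  simp only [coeffC, mul_assoc, Finset.sum_mul, Finset.mul_sum]
  rw [Finset.sum_comm' (t' := Finset.range ((∑ i, m i) + 1)) (s' := fun j => Finset.range (j + 1))]
  · refine Finset.sum_congr rfl fun j _ => ?_
    have h : (n : ℂ) ^ j =
        ∑ k ∈ Finset.range (j + 1), (Nat.stirlingSecond j k : ℂ) * (n.descFactorial k : ℂ) := by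
      exact_mod_cast pow_eq_sum_stirlingSecond n j
    rw [h, Finset.mul_sum, Finset.sum_div]
    refine Finset.sum_congr rfl fun k _ => ?_
    rw [sigmaCoeff, paramPoly]
    ring
  · intro k j
    simp only [Finset.mem_range, Finset.mem_Icc]
    omega

theorem poch_add_natCast_div {f : ℂ} (hf : ∀ k : ℕ, f ≠ -(k : ℂ)) (m n : ℕ) :
    poch (f + m) n / poch f n = poch (n + f) m / poch f m := by
  have h : ∀ n, poch f n ≠ 0 :=
        poch_ne_zero_of_forall_ne_neg hf
  rw [div_eq_div_iff (h n) (h m), mul_comm, ← poch_add, add_comm m n, poch_add,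
    add_comm f, mul_comm]

/-- The coefficients of the Cauchy product of `(1 - x) ^ (b + q)` with the hypergeometric series
of the left-hand side, for `c = a + m - q`. -/
def productCoeff {r : ℕ} (a b c : ℂ) (f : Fin r → ℂ) (m : Fin r → ℕ) (q N : ℕ) : ℂ :=
  ∑ i ∈ Finset.range (N + 1), poch (-b - q) (N - i) / ((N - i).factorial : ℂ) *
    (poch a i * poch b i / (poch c i * (i.factorial : ℂ)) *
      ((paramPoly f m).eval (i : ℂ) / pochVec f m))

/-- The part of the Cauchy product that comes from one falling factorial `n (n - 1) ⋯ (n - k + 1)`.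
In terms of functions it is Euler's transformation of a `₂F₁`. -/
theorem sum_descFactorial_eq {a b c : ℂ} (hc : ∀ k : ℕ, c ≠ -(k : ℂ)) (q k j : ℕ) :
    ∑ i ∈ Finset.range (k + j + 1), poch (-b - q) (k + j - i) / ((k + j - i).factorial : ℂ) *
      (poch a i * poch b i / (poch c i * (i.factorial : ℂ)) * (i.descFactorial k : ℂ)) =
    poch a k * poch b k / (poch c (k + j) * (j.factorial : ℂ)) *
      scaledF32 j (k - q + a - c) (-b - q) (k - q) (a - b - q + k) := by
  have hp : ∀ n, poch c n ≠ 0 :=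
        poch_ne_zero_of_forall_ne_neg hc
  have hf : ∀ n : ℕ, (n.factorial : ℂ) ≠ 0 := fun n => by exact_mod_cast n.factorial_ne_zero
  have h := sum_eq_scaledF32 (a + k) (b + k) (c + k) (k - q) j
  rw [show (k : ℂ) - q + (a + k) - (c + k) = k - q + a - c by ring,
    show (k : ℂ) - q - (b + k) = -b - q by ring,
    show a + (k : ℂ) - (b + k) + (k - q) = a - b - q + k by ring] at h
  rw [← h, Finset.mul_sum, show k + j + 1 = k + (j + 1) by ring, Finset.sum_range_add,
    Finset.sum_eq_zero, zero_add]
  · refine Finset.sum_congr rfl fun i hi => ?_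
    have hi' : i ≤ j := by simpa [Nat.lt_succ_iff] using hi
    have hd : ((k + i).descFactorial k : ℂ) = ((k + i).factorial : ℂ) / (i.factorial : ℂ) := by
      rw [eq_div_iff (hf i)]
      have := Nat.factorial_mul_descFactorial (Nat.le_add_right k i)
      rw [Nat.add_sub_cancel_left, mul_comm] at this
      exact_mod_cast this
    have hcs := poch_add (c + k) i (j - i)
    rw [Nat.add_sub_cancel' hi', add_assoc] at hcs
    have h1 := hp (k + j)
    rw [poch_add c k j] at h1 ⊢
    rw [show k + j - (k + i) = j - i by omega, hd, cast_choose_eq_div hi', poch_add a, poch_add b]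
    have h2 := hp (k + i)
    rw [poch_add c] at h2 ⊢
    have h3 := right_ne_zero_of_mul h1
    have h4 := left_ne_zero_of_mul h1
    have h5 := right_ne_zero_of_mul h2
    have h6 := hf (k + i)
    have h7 := hf i
    have h8 := hf (j - i)
    have h9 := hf j
    rw [add_assoc c]
    field_simp
    rw [hcs]
    ring
  · intro i hi
    rw [Nat.descFactorial_of_lt (Finset.mem_range.mp hi)]
    simp

theorem productCoeff_eq {r : ℕ} {a b c : ℂ} (hc : ∀ k : ℕ, c ≠ -(k : ℂ)) (f : Fin r → ℂ)
    (m : Fin r → ℕ) (q N : ℕ) :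
    productCoeff a b c f m q N = ∑ k ∈ Finset.range ((∑ i, m i) + 1),
      if k ≤ N then coeffC f m k * (poch a k * poch b k /
        (poch c N * ((N - k).factorial : ℂ)) *
          scaledF32 (N - k) (k - q + a - c) (-b - q) (k - q) (a - b - q + k)) else 0 := by
  simp only [productCoeff, ← sum_coeffC_mul_descFactorial, Finset.mul_sum]
  rw [Finset.sum_comm]
  refine Finset.sum_congr rfl fun k _ => ?_
  split_ifs with hk
  · obtain ⟨j, rfl⟩ := Nat.exists_eq_add_of_le hk
    rw [Nat.add_sub_cancel_left, ← sum_descFactorial_eq hc, Finset.mul_sum]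
    exact Finset.sum_congr rfl fun i _ => by ring
  · refine Finset.sum_eq_zero fun i hi => ?_
    rw [Nat.descFactorial_of_lt (by have := Finset.mem_range.mp hi; omega)]
    simp

/-! ### Evaluation of the coefficients of the Cauchy product -/

theorem factorial_cast_ne_zero (n : ℕ) : (n.factorial : ℂ) ≠ 0 := by
  exact_mod_cast n.factorial_ne_zero

theorem poch_sub_ne_zero {q M : ℕ} {x : ℂ}
    (h : ∀ i : ℤ, (q : ℤ) + 1 - M ≤ i → i ≤ q → x ≠ (i : ℂ)) {k : ℕ} (hk : k ≤ M) :
    poch (x - q) k ≠ 0 := by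
  refine poch_ne_zero fun i hi h0 => h (q - i) (by omega) (by omega) ?_
  push_cast
  linear_combination h0

theorem poch_sub_add_ne_zero {q M : ℕ} {x : ℂ}
    (h : ∀ i : ℤ, (q : ℤ) + 1 - M ≤ i → i ≤ q → x ≠ (i : ℂ)) {k i : ℕ} (hk : k + i ≤ M) :
    poch (x - q + k) i ≠ 0 := by
  have h1 := poch_sub_ne_zero h hk
  rw [poch_add] at h1
  exact right_ne_zero_of_mul h1

theorem poch_neg_natCast_ne_zero {q k : ℕ} (h : k ≤ q) : poch (-(q : ℂ)) k ≠ 0 := by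
  rw [poch_neg_natCast]
  have : q.choose k ≠ 0 := (Nat.choose_pos h).ne'
  have := k.factorial_ne_zero
  simp_all

/-- The coefficients of `x ^ N` for `N ≤ q`. -/
theorem productCoeff_of_le {r : ℕ} {a b : ℂ} (f : Fin r → ℂ) (m : Fin r → ℕ) {M q N : ℕ}
    (hM : M = ∑ j, m j) (hq : q < M) (hc : ∀ k : ℕ, a + M - q ≠ -(k : ℂ))
    (hab : ∀ i : ℤ, (q : ℤ) + 1 - M ≤ i → i ≤ q → a - b ≠ (i : ℂ)) (hN : N ≤ q) :
    productCoeff a b (a + M - q) f m q N =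
      poch (-(q : ℂ)) N * poch (a - b - q) N / (poch (a + M - q) N * (N.factorial : ℂ)) *
        hatQ a b f m q N := by
  have hcN : poch (a + M - q) N ≠ 0 :=
    poch_ne_zero_of_forall_ne_neg hc _
  rw [productCoeff_eq hc, hatQ, ← hM, Finset.mul_sum, ← Finset.sum_filter]
  have hfil : (Finset.range (M + 1)).filter (· ≤ N) = Finset.range (N + 1) := by
    ext k
    simp only [Finset.mem_filter, Finset.mem_range]
    omega
  rw [hfil]
  refine Finset.sum_congr rfl fun k hk => ?_
  have hk' : k ≤ N := by simpa [Nat.lt_succ_iff] using hk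
  have hq1 : poch (-(q : ℂ)) N ≠ 0 := poch_neg_natCast_ne_zero hN
  have hab1 : poch (a - b - q) N ≠ 0 := poch_sub_ne_zero hab (by omega)
  rw [poch_split _ hk'] at hq1 hab1
  rw [show (k : ℂ) - q + a - (a + M - q) = k - M by ring, scaledF32_eq]
  · have e1 : poch (-(q : ℂ)) N = poch (-(q : ℂ)) k * poch (k - q) (N - k) := by
      rw [poch_split _ hk', neg_add_eq_sub]
    have e2 : poch (a - b - q) N = poch (a - b - q) k * poch (a - b - q + k) (N - k) :=
      poch_split _ hk'
    have e3 : (-1) ^ k * poch (-(N : ℂ)) k = (N.factorial : ℂ) / ((N - k).factorial : ℂ) := by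
      have h1 : ((-1 : ℂ) ^ k) * (-1) ^ k = 1 := by rw [← mul_pow]; simp
      have := factorial_cast_ne_zero k
      have := factorial_cast_ne_zero (N - k)
      rw [poch_neg_natCast, cast_choose_eq_div hk']
      field_simp
      linear_combination (N.factorial : ℂ) * h1
    have h1 := left_ne_zero_of_mul hq1
    have h2 := left_ne_zero_of_mul hab1
    have h3 := factorial_cast_ne_zero N
    have h4 := factorial_cast_ne_zero (N - k)
    rw [e1, e2, e3]
    field_simp
  · intro i hi _
    constructor
    · have h := poch_neg_natCast_ne_zero (show k + i ≤ q by omega)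
      rw [poch_add, neg_add_eq_sub] at h
      exact right_ne_zero_of_mul h
    · exact poch_sub_add_ne_zero hab (by omega)

theorem eval_terminatingF32Poly (L : ℕ) (s v c d t : ℂ) :
    (terminatingF32Poly L s v c d).eval t = terminatingF32 L (t + s) v c d := by
  simp only [terminatingF32Poly, terminatingF32, eval_finsetSum, eval_mul, eval_C, eval_pochPoly]
  exact Finset.sum_congr rfl fun i _ => by ring

/-- A `₃F₂` with two top parameters in `-ℕ₀` may be terminated by either of them. -/
theorem terminatingF32_comm (L j : ℕ) (v c d : ℂ) :
    terminatingF32 L (-(j : ℂ)) v c d = terminatingF32 j (-(L : ℂ)) v c d := by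
  have key : ∀ L j : ℕ, terminatingF32 L (-(j : ℂ)) v c d =
      ∑ n ∈ Finset.range (L + j + 1), poch (-(L : ℂ)) n * poch (-(j : ℂ)) n * poch v n /
        (poch c n * poch d n * (n.factorial : ℂ)) := by
    intro L j
    rw [terminatingF32]
    refine Finset.sum_subset (Finset.range_subset_range.mpr (by omega)) fun n _ hn => ?_
    rw [Finset.mem_range] at hn
    rw [poch_neg_natCast_eq_zero (show L < n by omega)]
    simp
  rw [key, key, add_comm j L]
  exact Finset.sum_congr rfl fun n _ => by ring

theorem poch_neg_sub (q : ℕ) (a b : ℂ) :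
    poch (b - a) (q + 1) = (-1) ^ (q + 1) * poch (a - b - q) (q + 1) := by
  rw [← neg_sub a b, poch_neg]
  congr 2
  push_cast
  ring

/-- The contribution of `k ≤ q` to the coefficients of `x ^ (q + 1 + n)`. -/
theorem scaledF32_low (a b : ℂ) {M q k n : ℕ} (hq : q < M) (hk : k ≤ q)
    (hab : ∀ i : ℤ, (q : ℤ) + 1 - M ≤ i → i ≤ q → a - b ≠ (i : ℂ)) :
    poch b k / ((q + 1 + n - k).factorial : ℂ) *
        scaledF32 (q + 1 + n - k) (k - M) (-b - q) (k - q) (a - b - q + k) =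
      poch b (q + 1) * poch (-(M : ℂ) + k) (q - k + 1) / ((q - k + 1).factorial : ℂ) *
        poch (a - b + 1) n *
        terminatingF32 (M - q - 1) (-(n : ℂ)) (1 - b - k) (a - b + 1) (2 - (k : ℂ) + q) := by
  obtain ⟨p, rfl⟩ := Nat.exists_eq_add_of_le hk
  rw [terminatingF32_comm, show k + p + 1 + n - k = p + 1 + n by omega,
    show k + p - k + 1 = p + 1 by omega, scaledF32, terminatingF32,
    show p + 1 + n + 1 = (p + 1) + (n + 1) by ring, Finset.sum_range_add, Finset.sum_eq_zero,
    zero_add, Finset.mul_sum, Finset.mul_sum]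
  · refine Finset.sum_congr rfl fun i hi => ?_
    have hi' : i ≤ n := by simpa [Nat.lt_succ_iff] using hi
    have e1 : ((k : ℂ) - (k + p : ℕ) + (p + 1 + i : ℕ)) = i + 1 := by push_cast; ring
    have e2 : a - b - (k + p : ℕ) + k + (p + 1 + i : ℕ) = a - b + 1 + i := by push_cast; ring
    have e3 : p + 1 + n - (p + 1 + i) = n - i := by omega
    have e4 : (k : ℂ) - M + (p + 1 : ℕ) = -((M - (k + p) - 1 : ℕ) : ℂ) := by
      rw [Nat.sub_sub, Nat.cast_sub (by omega)]
      push_cast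
      ring
    have e5 : -b - (k + p : ℕ) + (p + 1 : ℕ) = 1 - b - k := by push_cast; ring
    have e6 : poch (-b - (k + p : ℕ)) (p + 1) = (-1) ^ (p + 1) * poch (b + k) (p + 1) := by
      rw [show -b - ((k + p : ℕ) : ℂ) = -(b + k + p) by push_cast; ring, poch_neg]
      congr 2
      push_cast
      ring
    have e7 : (2 : ℂ) - k + (k + p : ℕ) = (p + 1 : ℕ) + 1 := by push_cast; ring
    have e8 : poch b (k + p + 1) = poch b k * poch (b + k) (p + 1) := by
      rw [add_assoc, poch_add]
    have hi1 : poch (a - b + 1) i ≠ 0 ∨ poch (-((M - (k + p) - 1 : ℕ) : ℂ)) i = 0 := by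
      rcases le_or_gt i (M - (k + p) - 1) with h | h
      · left
        have := poch_sub_add_ne_zero hab (k := k + p + 1) (i := i) (by omega)
        rwa [show a - b - (k + p : ℕ) + (k + p + 1 : ℕ) = a - b + 1 by push_cast; ring] at this
      · exact Or.inr (poch_neg_natCast_eq_zero h)
    rw [e1, e2, e3, poch_add (k - M : ℂ), poch_add (-b - _), e4, e5, e6, e7, e8,
      neg_add_eq_sub, poch_split (a - b + 1) hi', poch_natCast_add_one, poch_natCast_add_one,
      poch_neg_natCast n i, cast_choose_eq_div hi',
      cast_choose_eq_div (show p + 1 + i ≤ p + 1 + n by omega), e3, Nat.add_sub_cancel' hi']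
    have h1 := factorial_cast_ne_zero (p + 1 + n)
    have h2 := factorial_cast_ne_zero (p + 1)
    have h3 := factorial_cast_ne_zero (p + 1 + i)
    have h4 := factorial_cast_ne_zero n
    have h5 := factorial_cast_ne_zero i
    have h6 := factorial_cast_ne_zero (n - i)
    have hs : ((-1 : ℂ) ^ (p + 1)) * (-1) ^ (p + 1) = 1 := by rw [← mul_pow]; simp
    rcases hi1 with hi1 | hi1
    · rw [pow_add]
      field_simp
      have hs2 : ((-1 : ℂ) ^ (p + 1)) ^ 2 = 1 := by rw [sq, hs]
      rw [hs2]
      ring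
    · rw [hi1]
      simp
  · intro i hi
    have h : poch ((k : ℂ) - (k + p : ℕ) + i) (p + 1 + n - i) = 0 := by
      have hip := Finset.mem_range.mp hi
      rw [show (k : ℂ) - (k + p : ℕ) + i = -((p - i : ℕ) : ℂ) by
        rw [Nat.cast_sub (by omega)]; push_cast; ring]
      exact poch_neg_natCast_eq_zero (by omega)
    rw [h]
    simp

/-- The contribution of `q + 1 ≤ k ≤ m` to the coefficients of `x ^ (q + 1 + n)`. -/
theorem scaledF32_high (a b : ℂ) {M q k n : ℕ} (hk : q + 1 ≤ k) (hkM : k ≤ M)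
    (hab : ∀ i : ℤ, (q : ℤ) + 1 - M ≤ i → i ≤ q → a - b ≠ (i : ℂ)) :
    (if k ≤ q + 1 + n then 1 / ((q + 1 + n - k).factorial : ℂ) *
        scaledF32 (q + 1 + n - k) (k - M) (-b - q) (k - q) (a - b - q + k) else 0) =
      poch (b - a) (q + 1) * poch (a - b + 1) n *
        ((-1) ^ k / (poch (a - b - q) k * ((k - q - 1).factorial : ℂ)) *
          poch (-(n : ℂ)) (k - q - 1) *
          terminatingF32 (M - k) (k - (q + 1 + n : ℕ)) (-b - q) (a - b - q + k) (k - q)) := by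
  obtain ⟨p, rfl⟩ := Nat.exists_eq_add_of_le hk
  have ep : q + 1 + p - q - 1 = p := by omega
  rw [ep, poch_neg_natCast]
  split_ifs with hpn
  · obtain ⟨j, rfl⟩ : ∃ j, n = p + j := ⟨n - p, by omega⟩
    have ej : q + 1 + (p + j) - (q + 1 + p) = j := by omega
    rw [ej, scaledF32_eq, show ((q + 1 + p : ℕ) : ℂ) - (q + 1 + (p + j) : ℕ) = -(j : ℂ) by
      push_cast; ring, terminatingF32_comm, poch_neg_sub]
    · have e1 : ((q + 1 + p : ℕ) : ℂ) - M = -((M - (q + 1 + p) : ℕ) : ℂ) := by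
        rw [Nat.cast_sub hkM]
        ring
      have e2 : poch (a - b - q) (q + 1) * poch (a - b + 1) (p + j) =
          poch (a - b - q) (q + 1 + p) * poch (a - b - q + (q + 1 + p : ℕ)) j := by
        rw [← poch_add, add_assoc (q + 1), poch_add _ (q + 1) (p + j)]
        congr 2
        push_cast
        ring
      have e3 : poch (((q + 1 + p : ℕ) : ℂ) - q) j =
          ((p + j).factorial : ℂ) / (p.factorial : ℂ) := by
        rw [← poch_natCast_add_one]
        congr 1
        push_cast
        ring
      have e4 : terminatingF32 j (-((M - (q + 1 + p) : ℕ) : ℂ)) (-b - q)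
          (((q + 1 + p : ℕ) : ℂ) - q) (a - b - q + (q + 1 + p : ℕ)) =
          terminatingF32 j (-((M - (q + 1 + p) : ℕ) : ℂ)) (-b - q)
          (a - b - q + (q + 1 + p : ℕ)) (((q + 1 + p : ℕ) : ℂ) - q) := by
        rw [terminatingF32, terminatingF32]
        exact Finset.sum_congr rfl fun i _ => by rw [mul_comm (poch (_ - _) i) (poch _ i)]
      have h0 : poch (a - b - q) (q + 1 + p) ≠ 0 := poch_sub_ne_zero hab hkM
      have hs : ((-1 : ℂ) ^ (q + 1)) * (-1) ^ (q + 1 + p) * (-1) ^ p = 1 := by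
        rw [← pow_add, ← pow_add]
        exact Even.neg_one_pow ⟨q + 1 + p, by ring⟩
      have h1 := factorial_cast_ne_zero p
      have h2 := factorial_cast_ne_zero j
      rw [e1, e3, e4, cast_choose_eq_div (Nat.le_add_right p j), Nat.add_sub_cancel_left]
      set T := terminatingF32 j (-((M - (q + 1 + p) : ℕ) : ℂ)) (-b - q)
          (a - b - q + (q + 1 + p : ℕ)) (((q + 1 + p : ℕ) : ℂ) - q)
      field_simp
      linear_combination (-((p + j).factorial : ℂ) * T * ((-1 : ℂ) ^ (q + 1)) *
          (-1) ^ (q + 1 + p) * (-1) ^ p) * e2 - ((p + j).factorial : ℂ) * T *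
          poch (a - b - q) (q + 1 + p) * poch (a - b - q + (q + 1 + p : ℕ)) j * hs
    · intro i hi hu
      have hiM : i ≤ M - (q + 1 + p) := by
        by_contra h
        refine hu ?_
        rw [show ((q + 1 + p : ℕ) : ℂ) - M = -((M - (q + 1 + p) : ℕ) : ℂ) by
          rw [Nat.cast_sub hkM]; ring]
        exact poch_neg_natCast_eq_zero (by omega)
      constructor
      · rw [show ((q + 1 + p : ℕ) : ℂ) - q = (p : ℂ) + 1 by push_cast; ring, poch_natCast_add_one]
        exact div_ne_zero (factorial_cast_ne_zero _) (factorial_cast_ne_zero _)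
      · exact poch_sub_add_ne_zero hab (by omega)
  · rw [Nat.choose_eq_zero_of_lt (by omega)]
    simp

/-- The coefficients of `x ^ (q + 1 + n)`. -/
theorem productCoeff_add {r : ℕ} {a b : ℂ} (f : Fin r → ℂ) (m : Fin r → ℕ) {M q : ℕ}
    (hM : M = ∑ j, m j) (hq : q < M) (hc : ∀ k : ℕ, a + M - q ≠ -(k : ℂ))
    (hab : ∀ i : ℤ, (q : ℤ) + 1 - M ≤ i → i ≤ q → a - b ≠ (i : ℂ)) (n : ℕ) :
    productCoeff a b (a + M - q) f m q (q + 1 + n) =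
      (hatR a b f m q).eval (-(q : ℂ) - 1 - n) * poch (b - a) (q + 1) * poch (a - b + 1) n /
        poch (a + M - q) (q + 1 + n) := by
  have hba : poch (b - a) (q + 1) ≠ 0 := by
    rw [poch_neg_sub]
    exact mul_ne_zero (pow_ne_zero _ (by norm_num)) (poch_sub_ne_zero hab (by omega))
  have hcN : poch (a + M - q) (q + 1 + n) ≠ 0 :=
    poch_ne_zero_of_forall_ne_neg hc _
  rw [productCoeff_eq hc, ← hM, Finset.range_eq_Ico,
    ← Finset.sum_Ico_consecutive _ (Nat.zero_le (q + 1)) (show q + 1 ≤ M + 1 by omega),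
    ← Finset.range_eq_Ico, show Finset.Ico (q + 1) (M + 1) = Finset.Icc (q + 1) M from rfl,
    hatR, ← hM, eval_add, add_mul, add_mul, add_div]
  simp only [eval_mul, eval_finsetSum, eval_C, eval_pochPoly, eval_terminatingF32Poly]
  congr 1
  · rw [Finset.mul_sum, Finset.sum_mul, Finset.sum_mul, Finset.sum_div]
    refine Finset.sum_congr rfl fun k hk => ?_
    have hk' : k ≤ q := by simpa [Nat.lt_succ_iff] using hk
    have h := scaledF32_low a b (n := n) hq hk' hab
    rw [if_pos (by omega), show (k : ℂ) - q + a - (a + M - q) = k - M by ring,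
      show -(q : ℂ) - 1 - n + (q + 1) = -(n : ℂ) by ring]
    calc _ = coeffC f m k * poch a k / poch (a + M - q) (q + 1 + n) *
          (poch b k / ((q + 1 + n - k).factorial : ℂ) *
            scaledF32 (q + 1 + n - k) (k - M) (-b - q) (k - q) (a - b - q + k)) := by
          have := factorial_cast_ne_zero (q + 1 + n - k)
          field_simp
      _ = _ := by
          rw [h]
          have := factorial_cast_ne_zero (q - k + 1)
          field_simp
  · rw [Finset.sum_mul, Finset.sum_mul, Finset.sum_div]
    refine Finset.sum_congr rfl fun k hk => ?_
    obtain ⟨hk1, hk2⟩ := Finset.mem_Icc.mp hk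
    have h := scaledF32_high a b (n := n) hk1 hk2 hab
    rw [show (k : ℂ) - q + a - (a + M - q) = k - M by ring,
      show -(q : ℂ) - 1 - n + (q + 1) = -(n : ℂ) by ring,
      show -(q : ℂ) - 1 - n + k = k - (q + 1 + n : ℕ) by push_cast; ring]
    calc _ = coeffC f m k * poch a k * poch b k / poch (a + M - q) (q + 1 + n) *
          (if k ≤ q + 1 + n then 1 / ((q + 1 + n - k).factorial : ℂ) *
            scaledF32 (q + 1 + n - k) (k - M) (-b - q) (k - q) (a - b - q + k) else 0) := by
          have := factorial_cast_ne_zero (q + 1 + n - k)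
          split_ifs
          · field_simp
          · simp
      _ = _ := by
          rw [h]
          ring

/-! ### Degree and special value of `hatR` -/

theorem natDegree_terminatingF32Poly_le (L : ℕ) (s v c d : ℂ) :
    (terminatingF32Poly L s v c d).natDegree ≤ L := by
  refine natDegree_sum_le_of_forall_le _ _ fun n hn => ?_
  refine (natDegree_C_mul_le _ _).trans ?_
  rw [natDegree_pochPoly]
  simpa [Nat.lt_succ_iff] using hn

theorem natDegree_hatR_le {r : ℕ} (a b : ℂ) (f : Fin r → ℂ) (m : Fin r → ℕ) (q : ℕ) :
    (hatR a b f m q).natDegree ≤ (∑ i, m i) - q - 1 := by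
  refine natDegree_add_le_of_degree_le ?_ ?_
  · refine (natDegree_C_mul_le _ _).trans (natDegree_sum_le_of_forall_le _ _ fun k _ => ?_)
    exact (natDegree_C_mul_le _ _).trans (natDegree_terminatingF32Poly_le _ _ _ _ _)
  · refine natDegree_sum_le_of_forall_le _ _ fun k hk => ?_
    obtain ⟨hk1, hk2⟩ := Finset.mem_Icc.mp hk
    refine natDegree_mul_le.trans ?_
    have h1 := natDegree_terminatingF32Poly_le ((∑ i, m i) - k) k (-b - q) (a - b - q + k) (k - q)
    have h2 := natDegree_C_mul_le ((-1) ^ k * poch a k * poch b k * coeffC f m k /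
      (poch (a - b - q) k * ((k - q - 1).factorial : ℂ))) (pochPoly ((q : ℂ) + 1) (k - q - 1))
    rw [natDegree_pochPoly] at h2
    omega

theorem poch_zero_left {n : ℕ} (h : n ≠ 0) : poch 0 n = 0 := by
  simp [poch, h]

theorem terminatingF32_zero (L : ℕ) (v c d : ℂ) : terminatingF32 L 0 v c d = 1 := by
  rw [terminatingF32, Finset.sum_eq_single_of_mem 0 (by simp)]
  · simp [poch_zero]
  · intro n _ hn
    simp [poch_zero_left hn]

theorem eval_hatR {r : ℕ} {a b : ℂ} (f : Fin r → ℂ) (m : Fin r → ℕ) {M q : ℕ}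
    (hM : M = ∑ j, m j) (hq : q < M) :
    (hatR a b f m q).eval (-(q : ℂ) - 1) = poch b (q + 1) / poch (b - a) (q + 1) *
      ∑ k ∈ Finset.range (q + 2), poch (-(M : ℂ) + k) (q + 1 - k) * poch a k * coeffC f m k /
        ((q + 1 - k).factorial : ℂ) := by
  rw [hatR, ← hM]
  simp only [eval_add, eval_mul, eval_finsetSum, eval_C, eval_pochPoly, eval_terminatingF32Poly]
  have h0 : -(q : ℂ) - 1 + (q + 1) = 0 := by ring
  rw [Finset.sum_range_succ _ (q + 1), mul_add,
    Finset.sum_eq_single_of_mem (q + 1) (Finset.mem_Icc.mpr ⟨le_rfl, hq⟩)]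
  · congr 1
    · congr 1
      refine Finset.sum_congr rfl fun k hk => ?_
      have hk' : k ≤ q := by simpa [Nat.lt_succ_iff] using hk
      rw [h0, terminatingF32_zero, mul_one, Nat.sub_add_comm hk']
    · rw [show -(q : ℂ) - 1 + (q + 1 : ℕ) = 0 by push_cast; ring, terminatingF32_zero,
        show q + 1 - q - 1 = 0 by omega, Nat.sub_self, poch_zero, poch_zero, poch_neg_sub q a b]
      have hinv : ((-1 : ℂ) ^ (q + 1))⁻¹ = (-1) ^ (q + 1) := by
        rw [inv_eq_iff_eq_inv, ← inv_pow, inv_neg_one]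
      simp only [Nat.factorial_zero, Nat.cast_one, div_eq_mul_inv, mul_inv, hinv]
      ring
  · intro k hk hne
    obtain ⟨hk1, hk2⟩ := Finset.mem_Icc.mp hk
    rw [h0, poch_zero_left (by omega)]
    simp

/-! ### The cut plane and the identity theorem -/

theorem hasSum_iff_of_eq {u v : ℕ → ℂ} {s : ℂ} (h : ∀ n, u n = v n) : HasSum u s ↔ HasSum v s := by
  rw [funext h]

theorem isOpen_cutPlane : IsOpen cutPlane := by
  have h : cutPlane = {x : ℂ | 1 ≤ x.re ∧ x.im = 0}ᶜ := rfl
  rw [h, isOpen_compl_iff]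
  exact (isClosed_le continuous_const Complex.continuous_re).inter
    (isClosed_eq Complex.continuous_im continuous_const)

theorem ball_subset_cutPlane : Metric.ball (0 : ℂ) 1 ⊆ cutPlane := by
  intro x hx h
  have h1 := Complex.re_le_norm x
  rw [mem_ball_zero_iff] at hx
  linarith [h.1]

theorem mem_cutPlane_of_norm_lt {x : ℂ} (hx : ‖x‖ < 1) : x ∈ cutPlane :=
  ball_subset_cutPlane (mem_ball_zero_iff.mpr hx)

theorem ofReal_mul_mem_cutPlane {x : ℂ} (hx : x ∈ cutPlane) {t : ℝ} (ht : t ∈ Set.Icc (0 : ℝ) 1) :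
    (t : ℂ) * x ∈ cutPlane := by
  intro h
  rw [Complex.re_ofReal_mul, Complex.im_ofReal_mul] at h
  obtain ⟨h1, h2⟩ := h
  have ht0 : t ≠ 0 := by
    rintro rfl
    linarith [zero_mul x.re]
  have hpos : 0 < t := lt_of_le_of_ne ht.1 ht0.symm
  refine hx ⟨?_, (mul_eq_zero.mp h2).resolve_left ht0⟩
  by_contra! hlt
  nlinarith [ht.2]

theorem isPreconnected_cutPlane : IsPreconnected cutPlane := by
  have h0 : (0 : ℂ) ∈ cutPlane := mem_cutPlane_of_norm_lt (by simp)
  have hs : StarConvex ℝ (0 : ℂ) cutPlane := by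
    rw [starConvex_iff_forall_pos h0]
    intro y hy s t hs ht hst
    have := ofReal_mul_mem_cutPlane hy (t := t) ⟨ht.le, by linarith⟩
    simpa using this
  exact (hs.isPathConnected h0).isConnected.isPreconnected

theorem one_sub_mem_slitPlane {x : ℂ} (hx : x ∈ cutPlane) : 1 - x ∈ Complex.slitPlane := by
  rw [Complex.mem_slitPlane_iff]
  by_contra! h
  refine hx ⟨?_, ?_⟩
  · have := h.1
    simp only [Complex.sub_re, Complex.one_re] at this
    linarith
  · simpa using h.2

theorem eqOn_cutPlane {F G : ℂ → ℂ} (hF : DifferentiableOn ℂ F cutPlane)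
    (hG : DifferentiableOn ℂ G cutPlane) (h : ∀ x, ‖x‖ < 1 → F x = G x) :
    Set.EqOn F G cutPlane := by
  rw [← Complex.analyticOnNhd_iff_differentiableOn isOpen_cutPlane] at hF hG
  refine hF.eqOn_of_preconnected_of_eventuallyEq hG isPreconnected_cutPlane
    (mem_cutPlane_of_norm_lt (x := 0) (by simp)) ?_
  filter_upwards [Metric.ball_mem_nhds (0 : ℂ) one_pos] with x hx
  exact h x (mem_ball_zero_iff.mp hx)

/-! ### Power series that continue to the cut plane -/

/-- `F` is holomorphic on `ℂ ∖ [1, ∞)` and is the sum of `∑ u n * x ^ n` in the unit disk. -/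
structure IsContinuation (u : ℕ → ℂ) (F : ℂ → ℂ) : Prop where
  differentiableOn : DifferentiableOn ℂ F cutPlane
  hasSum : ∀ x : ℂ, ‖x‖ < 1 → HasSum (fun n : ℕ => u n * x ^ n) (F x)

/-- The power series `∑ u n * x ^ n` converges in the unit disk and continues holomorphically to
`ℂ ∖ [1, ∞)`. -/
def Continuable (u : ℕ → ℂ) : Prop := ∃ F, IsContinuation u F

theorem IsContinuation.iteratedDeriv_eq {u : ℕ → ℂ} {F : ℂ → ℂ} (h : IsContinuation u F) (n : ℕ) :
    iteratedDeriv n F 0 = (n.factorial : ℂ) * u n := by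
  have h1 : HasFPowerSeriesAt F (FormalMultilinearSeries.ofScalars ℂ u) 0 := by
    rw [hasFPowerSeriesAt_iff]
    filter_upwards [Metric.ball_mem_nhds (0 : ℂ) one_pos] with x hx
    simpa [mul_comm] using h.hasSum x (mem_ball_zero_iff.mp hx)
  have h2 := h1.eq_formalMultilinearSeries h1.analyticAt.hasFPowerSeriesAt
  rw [FormalMultilinearSeries.ofScalars_series_eq_iff] at h2
  rw [h2]
  field_simp [factorial_cast_ne_zero n]

theorem Continuable.congr {u v : ℕ → ℂ} (h : Continuable u) (huv : ∀ n, v n = u n) :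
    Continuable v := by
  rwa [funext huv]

theorem Continuable.one : Continuable fun _ => 1 := by
  refine ⟨fun x => (1 - x)⁻¹, ?_, fun x hx => by simpa using hasSum_geometric_of_norm_lt_one hx⟩
  intro x hx
  have : 1 - x ≠ 0 := Complex.slitPlane_ne_zero (one_sub_mem_slitPlane hx)
  exact ((differentiableAt_id.const_sub 1).inv this).differentiableWithinAt

theorem Continuable.const_mul {u : ℕ → ℂ} (h : Continuable u) (s : ℂ) :
    Continuable fun n => s * u n := by
  obtain ⟨F, hF⟩ := h
  refine ⟨fun x => s * F x, hF.differentiableOn.const_mul s, fun x hx => ?_⟩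
  simpa [mul_assoc] using (hF.hasSum x hx).mul_left s

theorem Continuable.add {u v : ℕ → ℂ} (hu : Continuable u) (hv : Continuable v) :
    Continuable fun n => u n + v n := by
  obtain ⟨F, hF⟩ := hu
  obtain ⟨G, hG⟩ := hv
  refine ⟨fun x => F x + G x, hF.differentiableOn.add hG.differentiableOn, fun x hx => ?_⟩
  simpa [add_mul] using (hF.hasSum x hx).add (hG.hasSum x hx)

theorem Continuable.of_shift {u : ℕ → ℂ} (h : Continuable fun n => u (n + 1)) : Continuable u := by
  obtain ⟨F, hF⟩ := h
  refine ⟨fun x => u 0 + x * F x, (differentiableOn_id.mul hF.differentiableOn).const_add _,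
    fun x hx => ?_⟩
  have h1 := (hF.hasSum x hx).mul_left x
  have h2 : HasSum (fun n => u (n + 1) * x ^ (n + 1)) (x * F x) :=
    (hasSum_iff_of_eq fun n => by ring).mpr h1
  simpa using h2.zero_add (f := fun n => u n * x ^ n)

theorem Continuable.shift {u : ℕ → ℂ} (h : Continuable u) : Continuable fun n => u (n + 1) := by
  obtain ⟨F, hF⟩ := h
  have h0 : F 0 = u 0 := by simpa using hF.iteratedDeriv_eq 0
  have h1 : deriv F 0 = u 1 := by simpa using hF.iteratedDeriv_eq 1
  refine ⟨dslope F 0, (Complex.differentiableOn_dslope (isOpen_cutPlane.mem_nhds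
    (mem_cutPlane_of_norm_lt (by simp)))).mpr hF.differentiableOn, fun x hx => ?_⟩
  rcases eq_or_ne x 0 with rfl | hx0
  · rw [dslope_same, h1]
    have := hasSum_single (f := fun n => u (n + 1) * (0 : ℂ) ^ n) 0 (by simp +contextual)
    simpa using this
  · rw [dslope_of_ne _ hx0, slope_def_field, h0, sub_zero]
    have h2 := (hasSum_nat_add_iff' (f := fun n => u n * x ^ n) 1).mpr (hF.hasSum x hx)
    have h3 := h2.div_const x
    simp only [Finset.range_one, Finset.sum_singleton, pow_zero, mul_one] at h3
    refine (hasSum_iff_of_eq fun n => ?_).mpr h3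
    field_simp
    ring

theorem Continuable.natCast_mul {u : ℕ → ℂ} (h : Continuable u) :
    Continuable fun n => (n : ℂ) * u n := by
  obtain ⟨F, hF⟩ := h
  have hd := hF.differentiableOn.deriv isOpen_cutPlane
  refine Continuable.of_shift ⟨deriv F, hd, fun x hx => ?_⟩
  have h1 := Complex.hasSum_taylorSeries_on_ball (hd.mono ball_subset_cutPlane)
    (mem_ball_zero_iff.mpr hx)
  refine (hasSum_iff_of_eq fun n => ?_).mpr h1
  rw [← iteratedDeriv_succ', hF.iteratedDeriv_eq, Nat.factorial_succ]
  have := factorial_cast_ne_zero n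
  simp only [smul_eq_mul, sub_zero]
  push_cast
  field_simp

theorem Continuable.eval_natCast_mul {u : ℕ → ℂ} (h : Continuable u) (p : ℂ[X]) :
    Continuable fun n => p.eval (n : ℂ) * u n := by
  induction p using Polynomial.induction_on with
  | C s => simpa using h.const_mul s
  | add p q hp hq => simpa [add_mul] using hp.add hq
  | monomial n s ih =>
    refine ih.natCast_mul.congr fun k => ?_
    simp only [eval_mul, eval_C, eval_pow, eval_X]
    ring

/-! ### Euler's integral and Hadamard products with `(a)_n / (c)_n` -/

theorem add_natCast_ne_zero_of_re_pos {s : ℂ} (hs : 0 < s.re) (n : ℕ) : s + n ≠ 0 := by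
  intro h
  have h1 := congrArg Complex.re h
  simp only [Complex.add_re, Complex.natCast_re, Complex.zero_re] at h1
  have h2 : (0 : ℝ) ≤ n := n.cast_nonneg
  linarith

theorem Gamma_add_natCast {s : ℂ} (hs : 0 < s.re) (n : ℕ) :
    Complex.Gamma (s + n) = poch s n * Complex.Gamma s := by
  induction n with
  | zero => simp [poch_zero]
  | succ n ih =>
    have h : s + n ≠ 0 := add_natCast_ne_zero_of_re_pos hs n
    rw [Nat.cast_succ, ← add_assoc, Complex.Gamma_add_one _ h, ih, poch_succ]
    ring

theorem betaIntegral_add_natCast {a c : ℂ} (ha : 0 < a.re) (hac : a.re < c.re) (n : ℕ) :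
    Complex.betaIntegral (a + n) (c - a) = Complex.betaIntegral a (c - a) *
      (poch a n / poch c n) := by
  have hca : 0 < (c - a).re := by simpa using hac
  have hc : 0 < c.re := ha.trans hac
  have h1 := Complex.Gamma_mul_Gamma_eq_betaIntegral ha hca
  have h2 := Complex.Gamma_mul_Gamma_eq_betaIntegral (s := a + n) (t := c - a)
    (by simp only [Complex.add_re, Complex.natCast_re]; positivity) hca
  rw [add_sub_cancel] at h1
  rw [show a + n + (c - a) = c + n by ring, Gamma_add_natCast ha, Gamma_add_natCast hc] at h2
  have hG : Complex.Gamma c ≠ 0 := Complex.Gamma_ne_zero_of_re_pos hc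
  have hp : poch c n ≠ 0 := poch_ne_zero fun i _ => add_natCast_ne_zero_of_re_pos hc i
  rw [← mul_div_assoc, eq_div_iff hp]
  refine mul_left_cancel₀ hG ?_
  linear_combination (-1 : ℂ) * h2 + poch a n * h1

/-- Integration of `F (t x)` against a weight on `[0, 1]` preserves holomorphy on the cut plane. -/
theorem differentiableOn_integral_scale {F : ℂ → ℂ} (hF : DifferentiableOn ℂ F cutPlane)
    {w : ℝ → ℂ} (hw : IntervalIntegrable w MeasureTheory.volume 0 1) :
    DifferentiableOn ℂ (fun x => ∫ t in (0 : ℝ)..1, w t * F (t * x)) cutPlane := by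
  intro x₀ hx₀
  obtain ⟨ε, hε, hball⟩ := Metric.nhds_basis_closedBall.mem_iff.mp
    (isOpen_cutPlane.mem_nhds hx₀)
  have hd := (hF.deriv isOpen_cutPlane).continuousOn
  have hK : IsCompact ((fun z : ℝ × ℂ => (z.1 : ℂ) * z.2) ''
      (Set.Icc (0 : ℝ) 1 ×ˢ Metric.closedBall x₀ ε)) :=
    (isCompact_Icc.prod (isCompact_closedBall x₀ ε)).image (by fun_prop)
  obtain ⟨K, hKb⟩ := hK.exists_bound_of_continuousOn (f := deriv F) (hd.mono (by
    rintro _ ⟨z, hz, rfl⟩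
    exact ofReal_mul_mem_cutPlane (hball hz.2) hz.1))
  have hcont : ∀ {G : ℂ → ℂ}, ContinuousOn G cutPlane → ∀ x ∈ cutPlane,
      ContinuousOn (fun t : ℝ => G (t * x)) (Set.uIcc 0 1) := by
    intro G hG x hx
    rw [Set.uIcc_of_le zero_le_one]
    exact hG.comp (by fun_prop) fun t ht => ofReal_mul_mem_cutPlane hx ht
  have hint : ∀ x ∈ cutPlane,
      IntervalIntegrable (fun t => w t * F (t * x)) MeasureTheory.volume 0 1 := fun x hx =>
    hw.mul_continuousOn (hcont hF.continuousOn x hx)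
  have hmem : ∀ t ∈ Set.uIoc (0 : ℝ) 1, t ∈ Set.Icc (0 : ℝ) 1 := by
    intro t ht
    rw [Set.uIoc_of_le zero_le_one] at ht
    exact Set.Ioc_subset_Icc_self ht
  have hint' : IntervalIntegrable (fun t => w t * (t * deriv F (t * x₀)))
      MeasureTheory.volume 0 1 :=
    hw.mul_continuousOn ((Complex.continuous_ofReal.continuousOn).mul (hcont hd x₀ hx₀))
  have key := intervalIntegral.hasDerivAt_integral_of_dominated_loc_of_deriv_le
    (μ := MeasureTheory.volume) (a := 0) (b := 1) (F := fun x t => w t * F (t * x))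
    (F' := fun x t => w t * (t * deriv F (t * x))) (bound := fun t => ‖w t‖ * K)
    (Metric.closedBall_mem_nhds x₀ hε)
    (by
      filter_upwards [isOpen_cutPlane.mem_nhds hx₀] with x hx
      exact (hint x hx).def'.aestronglyMeasurable)
    (hint x₀ hx₀) hint'.def'.aestronglyMeasurable
    (by
      refine Filter.Eventually.of_forall fun t ht x hx => ?_
      have ht' := hmem t ht
      have hb := hKb _ ⟨(t, x), ⟨ht', hx⟩, rfl⟩
      rw [norm_mul, norm_mul, Complex.norm_real, Real.norm_of_nonneg ht'.1]
      refine mul_le_mul_of_nonneg_left ?_ (norm_nonneg _)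
      exact (mul_le_of_le_one_left (norm_nonneg _) ht'.2).trans hb)
    (hw.norm.mul_const K)
    (by
      refine Filter.Eventually.of_forall fun t ht x hx => ?_
      have h1 := (hF.differentiableAt (isOpen_cutPlane.mem_nhds
        (ofReal_mul_mem_cutPlane (hball hx) (hmem t ht)))).hasDerivAt
      have h2 : HasDerivAt (fun y : ℂ => (t : ℂ) * y) t x := by
        simpa using (hasDerivAt_id x).const_mul (t : ℂ)
      have h3 := (HasDerivAt.comp x h1 h2).const_mul (w t)
      rw [mul_comm (deriv F _)] at h3
      exact h3)
  exact key.2.differentiableAt.differentiableWithinAt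

theorem Continuable.poch_div_mul_of_re {u : ℕ → ℂ} (h : Continuable u) {a c : ℂ}
    (ha : 0 < a.re) (hac : a.re < c.re) :
    Continuable fun n => poch a n / poch c n * u n := by
  obtain ⟨F, hF⟩ := h
  have hca : 0 < (c - a).re := by simpa using hac
  have hB : Complex.betaIntegral a (c - a) ≠ 0 := by
    have h1 := Complex.Gamma_mul_Gamma_eq_betaIntegral ha hca
    intro h0
    rw [h0, mul_zero] at h1
    exact mul_ne_zero (Complex.Gamma_ne_zero_of_re_pos ha)
      (Complex.Gamma_ne_zero_of_re_pos hca) h1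
  have hw := Complex.betaIntegral_convergent ha hca
  obtain ⟨w, hwdef⟩ : ∃ w : ℝ → ℂ,
      w = fun t : ℝ => (t : ℂ) ^ (a - 1) * (1 - (t : ℂ)) ^ (c - a - 1) := ⟨_, rfl⟩
  rw [← hwdef] at hw
  suffices hmom : Continuable fun n => Complex.betaIntegral (a + n) (c - a) * u n by
    refine (hmom.const_mul (Complex.betaIntegral a (c - a))⁻¹).congr fun n => ?_
    rw [betaIntegral_add_natCast ha hac]
    field_simp
  refine ⟨fun x => ∫ t in (0 : ℝ)..1, w t * F (t * x),
    differentiableOn_integral_scale hF.differentiableOn hw, fun x hx => ?_⟩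
  have hsum : Summable fun n => ‖u n‖ * ‖x‖ ^ n := by
    simpa using (hF.hasSum x hx).summable.norm
  have hmem : ∀ t ∈ Set.uIoc (0 : ℝ) 1, 0 < t ∧ t ≤ 1 := by
    intro t ht
    rwa [Set.uIoc_of_le zero_le_one] at ht
  have key := intervalIntegral.hasSum_integral_of_dominated_convergence
    (μ := MeasureTheory.volume) (a := 0) (b := 1) (f := fun t => w t * F (t * x))
    (F := fun (n : ℕ) t => w t * (u n * (t * x) ^ n))
    (fun n t => ‖w t‖ * (‖u n‖ * ‖x‖ ^ n))
    (fun n => (hw.mul_continuousOn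
      (g := fun t : ℝ => u n * (t * x) ^ n) (by fun_prop)).def'.aestronglyMeasurable)
    (fun n => Filter.Eventually.of_forall fun t ht => by
      obtain ⟨h0, h1⟩ := hmem t ht
      rw [norm_mul, norm_mul, norm_pow, norm_mul, Complex.norm_real, Real.norm_of_nonneg h0.le]
      gcongr
      exact mul_le_of_le_one_left (norm_nonneg _) h1)
    (Filter.Eventually.of_forall fun t _ => hsum.mul_left _)
    (by
      simp only [tsum_mul_left]
      exact hw.norm.mul_const _)
    (Filter.Eventually.of_forall fun t ht => by
      obtain ⟨h0, h1⟩ := hmem t ht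
      refine (hF.hasSum _ ?_).mul_left _
      rw [norm_mul, Complex.norm_real, Real.norm_of_nonneg h0.le]
      exact (mul_le_of_le_one_left (norm_nonneg _) h1).trans_lt hx)
  refine (hasSum_iff_of_eq fun n => ?_).mpr key
  rw [Complex.betaIntegral, mul_assoc, ← intervalIntegral.integral_mul_const]
  refine intervalIntegral.integral_congr_ae (Filter.Eventually.of_forall fun t ht => ?_)
  have ht0 : (t : ℂ) ≠ 0 := by exact_mod_cast (hmem t ht).1.ne'
  rw [hwdef, show a + (n : ℂ) - 1 = a - 1 + n by ring, Complex.cpow_add _ _ ht0,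
    Complex.cpow_natCast, mul_pow]
  ring

/-- The Hadamard product with `(a)_n / (c)_n` preserves continuability: in the half-plane
`0 < re a < re c` by Euler's integral, in general by contiguity and by shifts of the index. -/
theorem Continuable.poch_div_mul {u : ℕ → ℂ} (h : Continuable u) (a : ℂ) {c : ℂ}
    (hc : ∀ k : ℕ, c ≠ -(k : ℂ)) : Continuable fun n => poch a n / poch c n * u n := by
  have step : ∀ (L : ℕ) (a c : ℂ), (∀ k : ℕ, c ≠ -(k : ℂ)) → 0 < a.re → a.re < c.re + L →
      ∀ u : ℕ → ℂ, Continuable u → Continuable fun n => poch a n / poch c n * u n := by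
    intro L
    induction L with
    | zero =>
      intro a c _ ha hac u hu
      exact hu.poch_div_mul_of_re ha (by simpa using hac)
    | succ L ih =>
      intro a c hc ha hac u hu
      have h1 := ih a (c + 1)
        (fun k hk => hc (k + 1) (by push_cast; linear_combination hk)) ha
        (by push_cast at hac; simp only [Complex.add_re, Complex.one_re]; linarith) u hu
      refine ((h1.eval_natCast_mul (X + C c)).const_mul (1 / c)).congr fun n => ?_
      have hc0 : c ≠ 0 := by simpa using hc 0
      have hn : ∀ n, poch c n ≠ 0 :=
        poch_ne_zero_of_forall_ne_neg hc
      have hs : poch c n * (c + n) = c * poch (c + 1) n := by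
        rw [← poch_succ, poch_succ_left]
      have h2 : poch (c + 1) n ≠ 0 := by
        have := hn (n + 1)
        rw [poch_succ_left] at this
        exact right_ne_zero_of_mul this
      have h3 := hn n
      simp only [eval_add, eval_X, eval_C]
      field_simp
      linear_combination (-(poch a n * u n)) * hs
  obtain ⟨K, hK⟩ := exists_nat_gt (-a.re)
  replace hK : 0 < a.re + K := by linarith
  induction K generalizing a c u with
  | zero =>
    obtain ⟨L, hL⟩ := exists_nat_gt (a.re - c.re)
    exact step L a c hc (by simpa using hK) (by linarith) u h
  | succ K ih =>
    have hc' : ∀ k : ℕ, c + 1 ≠ -(k : ℂ) := fun k hk =>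
      hc (k + 1) (by push_cast; linear_combination hk)
    have h1 := ih h.shift (a + 1) hc'
      (by push_cast at hK; simp only [Complex.add_re, Complex.one_re]; linarith)
    refine Continuable.of_shift ?_
    refine (h1.const_mul (a / c)).congr fun n => ?_
    rw [poch_succ_left, poch_succ_left, mul_div_mul_comm]
    ring

/-! ### The hypergeometric functions of the transformation -/

theorem isHypContinuation_hypF {as bs : Multiset ℂ} (h : Continuable (hypCoeff as bs)) :
    IsHypContinuation as bs (hypF as bs) := by
  obtain ⟨F, hF⟩ := h
  exact Classical.epsilon_spec (p := IsHypContinuation as bs)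
    ⟨F, hF.differentiableOn, hF.hasSum⟩

theorem hasSum_one_sub_cpow (e : ℂ) {x : ℂ} (hx : ‖x‖ < 1) :
    HasSum (fun n : ℕ => poch (-e) n / (n.factorial : ℂ) * x ^ n) ((1 - x) ^ e) := by
  have hx' : -x ∈ Metric.eball (0 : ℂ) 1 := by
    rw [← ENNReal.ofReal_one, Metric.eball_ofReal]
    simpa using hx
  have h := (Complex.one_add_cpow_hasFPowerSeriesOnBall_zero (a := e)).hasSum hx'
  rw [zero_add, ← sub_eq_add_neg] at h
  refine (hasSum_iff_of_eq fun n => ?_).mpr h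
  have hc : Ring.choose e n = (-1) ^ n * poch (-e) n / (n.factorial : ℂ) := by
    rw [Ring.choose_eq_smul, descPochhammer_smeval_eq_ascPochhammer, ascPochhammer_smeval_cast,
      ascPochhammer_smeval_eq_eval, poch_neg, ← mul_assoc, ← mul_pow, poch, smul_eq_mul]
    norm_num
    rw [div_eq_inv_mul]
  have hs : ((-1 : ℂ) ^ n) * (-1) ^ n = 1 := by rw [← mul_pow]; simp
  simp only [binomialSeries_apply, List.ofFn_const, List.prod_replicate, smul_eq_mul, hc]
  rw [neg_pow]
  linear_combination (-(poch (-e) n / (n.factorial : ℂ) * x ^ n)) * hs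

theorem hypCoeff_paramPoly {r : ℕ} (a b c : ℂ) (f : Fin r → ℂ) (m : Fin r → ℕ)
    (hf : ∀ j, ∀ k : ℕ, f j ≠ -(k : ℂ)) (n : ℕ) :
    hypCoeff (a ::ₘ b ::ₘ (Finset.univ : Finset (Fin r)).val.map fun j => f j + m j)
      (c ::ₘ (Finset.univ : Finset (Fin r)).val.map f) n =
    poch a n * poch b n / (poch c n * (n.factorial : ℂ)) *
      ((paramPoly f m).eval (n : ℂ) / pochVec f m) := by
  have h : (paramPoly f m).eval (n : ℂ) / pochVec f m =
      (∏ j, poch (f j + m j) n) / ∏ j, poch (f j) n := by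
    rw [eval_paramPoly, pochVec, ← Finset.prod_div_distrib, ← Finset.prod_div_distrib]
    exact Finset.prod_congr rfl fun j _ => (poch_add_natCast_div (hf j) (m j) n).symm
  rw [h, hypCoeff, Multiset.map_cons, Multiset.map_cons, Multiset.map_cons, Multiset.prod_cons,
    Multiset.prod_cons, Multiset.prod_cons, Multiset.map_map, Multiset.map_map]
  change poch a n * (poch b n * ∏ j, poch (f j + m j) n) /
    (poch c n * (∏ j, poch (f j) n) * (n.factorial : ℂ)) = _
  simp only [div_eq_mul_inv, mul_inv]
  ring

theorem continuable_paramPoly {r : ℕ} (a b : ℂ) {c : ℂ} (f : Fin r → ℂ) (m : Fin r → ℕ)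
    (hc : ∀ k : ℕ, c ≠ -(k : ℂ)) (hf : ∀ j, ∀ k : ℕ, f j ≠ -(k : ℂ)) :
    Continuable (hypCoeff (a ::ₘ b ::ₘ (Finset.univ : Finset (Fin r)).val.map fun j => f j + m j)
      (c ::ₘ (Finset.univ : Finset (Fin r)).val.map f)) := by
  have h1 : ∀ k : ℕ, (1 : ℂ) ≠ -(k : ℂ) := fun k h => by
    have : ((k + 1 : ℕ) : ℂ) = 0 := by push_cast; linear_combination h
    exact k.succ_ne_zero (by exact_mod_cast this)
  refine ((((Continuable.one.eval_natCast_mul (paramPoly f m)).const_mul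
    (1 / pochVec f m)).poch_div_mul b h1).poch_div_mul a hc).congr fun n => ?_
  rw [hypCoeff_paramPoly a b c f m hf, poch_one_left]
  simp only [div_eq_mul_inv, mul_inv]
  ring

/-- The parameter pairs `γ + s + 1` over `γ + s` contribute a polynomial factor. -/
theorem hypCoeff_roots (a' c' s : ℂ) (Γ : Multiset ℂ)
    (hΓ : ∀ γ ∈ Γ, ∀ k : ℕ, γ + s ≠ -(k : ℂ)) (n : ℕ) :
    hypCoeff (1 ::ₘ a' ::ₘ Γ.map fun γ => γ + (s + 1)) (c' ::ₘ Γ.map fun γ => γ + s) n =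
      poch a' n / poch c' n * (Γ.map fun γ => (γ + s + n) / (γ + s)).prod := by
  have h : (Γ.map fun γ => (γ + s + n) / (γ + s)).prod =
      (Γ.map fun γ => poch (γ + (s + 1)) n).prod / (Γ.map fun γ => poch (γ + s) n).prod := by
    rw [← Multiset.prod_map_div]
    congr 1
    refine Multiset.map_congr rfl fun γ hγ => ?_
    have := poch_add_natCast_div (hΓ γ hγ) 1 n
    rw [poch_one, poch_one, Nat.cast_one, add_assoc γ s 1] at this
    rw [this, add_comm (n : ℂ)]
  have hn := factorial_cast_ne_zero n
  rw [h, hypCoeff, Multiset.map_cons, Multiset.map_cons, Multiset.map_cons, Multiset.prod_cons,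
    Multiset.prod_cons, Multiset.prod_cons, Multiset.map_map, Multiset.map_map, poch_one_left]
  simp only [Function.comp_def]
  rw [mul_comm _ (n.factorial : ℂ), mul_div_mul_left _ _ hn, mul_div_mul_comm]

theorem continuable_roots (a' : ℂ) {c' : ℂ} (s : ℂ) (Γ : Multiset ℂ)
    (hc : ∀ k : ℕ, c' ≠ -(k : ℂ)) (hΓ : ∀ γ ∈ Γ, ∀ k : ℕ, γ + s ≠ -(k : ℂ)) :
    Continuable (hypCoeff (1 ::ₘ a' ::ₘ Γ.map fun γ => γ + (s + 1))
      (c' ::ₘ Γ.map fun γ => γ + s)) := by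
  refine ((Continuable.one.eval_natCast_mul
    (Γ.map fun γ => (X + C (γ + s)) * C (γ + s)⁻¹).prod).poch_div_mul a' hc).congr fun n => ?_
  rw [hypCoeff_roots a' c' s Γ hΓ, eval_multiset_prod, Multiset.map_map, mul_one]
  congr 3
  funext γ
  simp only [Function.comp_apply, eval_mul, eval_add, eval_X, eval_C, div_eq_mul_inv]
  ring

/-- The polynomial factor of `hypCoeff_roots` recovers the values of the polynomial with the given
roots. For the zero polynomial both sides vanish. -/
theorem eval_mul_prod_roots (p : ℂ[X]) (s : ℂ) (h : ∀ γ ∈ p.roots, γ + s ≠ 0) (n : ℕ) :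
    p.eval (-s) * (p.roots.map fun γ => (γ + s + n) / (γ + s)).prod = p.eval (-s - n) := by
  rw [(IsAlgClosed.splits p).eval_eq_prod_roots, (IsAlgClosed.splits p).eval_eq_prod_roots,
    mul_assoc, ← Multiset.prod_map_mul]
  congr 2
  refine Multiset.map_congr rfl fun γ hγ => ?_
  have := h γ hγ
  field_simp
  ring

theorem hasSum_productCoeff {r : ℕ} (a b c : ℂ) (f : Fin r → ℂ) (m : Fin r → ℕ) (q : ℕ)
    (hf : ∀ j, ∀ k : ℕ, f j ≠ -(k : ℂ)) {x S : ℂ} (hx : ‖x‖ < 1)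
    (hS : HasSum (fun n => hypCoeff
      (a ::ₘ b ::ₘ (Finset.univ : Finset (Fin r)).val.map fun j => f j + m j)
      (c ::ₘ (Finset.univ : Finset (Fin r)).val.map f) n * x ^ n) S) :
    HasSum (fun N => productCoeff a b c f m q N * x ^ N) ((1 - x) ^ (b + q) * S) := by
  have hb := hasSum_one_sub_cpow (b + q) hx
  rw [show -(b + (q : ℂ)) = -b - q by ring] at hb
  have h1 := tsum_mul_tsum_eq_tsum_sum_range_of_summable_norm hS.summable.norm hb.summable.norm
  have h2 := (summable_norm_sum_mul_range_of_summable_norm hS.summable.norm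
    hb.summable.norm).of_norm.hasSum
  rw [← h1, hS.tsum_eq, hb.tsum_eq, mul_comm] at h2
  refine (hasSum_iff_of_eq fun N => ?_).mpr h2
  rw [productCoeff, Finset.sum_mul]
  refine Finset.sum_congr rfl fun i hi => ?_
  have hi' : i ≤ N := by simpa [Nat.lt_succ_iff] using hi
  rw [hypCoeff_paramPoly a b c f m hf, ← pow_sub_mul_pow x hi']
  ring

end MillerParis

end

theorem theorem3 (r : ℕ) (a b : ℂ) (f : Fin r → ℂ) (m : Fin r → ℕ) (M q : ℕ)
    (hm : ∀ j, 1 ≤ m j) (hM : M = ∑ j, m j) (hq : q < M)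
    (hf : ∀ j, ∀ k : ℕ, f j ≠ -(k : ℂ))
    (hc : ∀ k : ℕ, a + M - q ≠ -(k : ℂ))
    (hab : ∀ i : ℤ, (q : ℤ) + 1 - M ≤ i → i ≤ q → a - b ≠ (i : ℂ))
    (hfa : ∀ j, (M : ℤ) - q - m j ≤ 0 →
      ∀ i : ℤ, (M : ℤ) - q - m j ≤ i → i ≤ 0 → f j - a ≠ (i : ℂ)) :
    (MillerParis.hatR a b f m q).natDegree ≤ M - q - 1 ∧
    (MillerParis.hatR a b f m q).eval (-(q : ℂ) - 1) =
      MillerParis.poch b (q + 1) / MillerParis.poch (b - a) (q + 1) *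
        ∑ k ∈ Finset.range (q + 2),
          MillerParis.poch (-(M : ℂ) + k) (q + 1 - k) * MillerParis.poch a k *
            MillerParis.coeffC f m k / ((q + 1 - k).factorial : ℂ) ∧
    ((∀ γ ∈ (MillerParis.hatR a b f m q).roots, ∀ k : ℕ, γ + q + 1 ≠ -(k : ℂ)) →
      ∀ x ∈ MillerParis.cutPlane,
        (1 - x) ^ (b + q) *
            MillerParis.hypF
              (a ::ₘ b ::ₘ (Finset.univ : Finset (Fin r)).val.map fun j => f j + m j)
              ((a + M - q) ::ₘ (Finset.univ : Finset (Fin r)).val.map f) x =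
          (∑ j ∈ Finset.range (q + 1),
            MillerParis.poch (-(q : ℂ)) j * MillerParis.poch (a - b - q) j /
                (MillerParis.poch (a + M - q) j * (j.factorial : ℂ)) *
              MillerParis.hatQ a b f m q j * x ^ j) +
          x ^ (q + 1) *
            ((MillerParis.hatR a b f m q).eval (-(q : ℂ) - 1) *
                MillerParis.poch (b - a) (q + 1) / MillerParis.poch (a + M - q) (q + 1)) *
            MillerParis.hypF
              (1 ::ₘ (a - b + 1) ::ₘ
                (MillerParis.hatR a b f m q).roots.map fun γ => γ + q + 2)
              ((a + M + 1) ::ₘ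
                (MillerParis.hatR a b f m q).roots.map fun γ => γ + q + 1) x) := by
  have hc' : ∀ k : ℕ, a + M + 1 ≠ -(k : ℂ) := fun k h =>
    hc (k + q + 1) (by push_cast; linear_combination h)
  refine ⟨hM ▸ MillerParis.natDegree_hatR_le a b f m q, MillerParis.eval_hatR f m hM hq,
    fun hγ => ?_⟩
  obtain ⟨R, hR⟩ : ∃ R, R = MillerParis.hatR a b f m q := ⟨_, rfl⟩
  have hγ' : ∀ γ ∈ R.roots, ∀ k : ℕ, γ + ((q : ℂ) + 1) ≠ -(k : ℂ) := fun γ h k => by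
    rw [← add_assoc]
    exact hγ γ (hR ▸ h) k
  have hL := MillerParis.isHypContinuation_hypF
    (MillerParis.continuable_paramPoly a b f m hc hf)
  have hG := MillerParis.isHypContinuation_hypF
    (MillerParis.continuable_roots (a - b + 1) (q + 1) R.roots hc' hγ')
  have e1 : (fun γ : ℂ => γ + q + 1) = fun γ => γ + ((q : ℂ) + 1) := by
    funext γ
    ring
  have e2 : (fun γ : ℂ => γ + q + 2) = fun γ => γ + ((q : ℂ) + 1 + 1) := by
    funext γ
    ring
  rw [← hR, e1, e2]
  -- By the identity theorem it is enough to compare the power series at the origin.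
  refine MillerParis.eqOn_cutPlane (DifferentiableOn.mul ?_ hL.differentiableOn)
    (DifferentiableOn.add (by fun_prop)
      (DifferentiableOn.mul (by fun_prop) hG.differentiableOn)) fun x hx => ?_
  · exact ((differentiableOn_const 1).sub differentiableOn_id).cpow (differentiableOn_const _)
      fun x hx => MillerParis.one_sub_mem_slitPlane hx
  · refine (MillerParis.hasSum_productCoeff a b _ f m q hf hx (hL.hasSum x hx)).unique ?_
    have h1 := (hG.hasSum x hx).mul_left (x ^ (q + 1) * (R.eval (-(q : ℂ) - 1) *
      MillerParis.poch (b - a) (q + 1) / MillerParis.poch (a + M - q) (q + 1)))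
    have h2 : ∀ n : ℕ, MillerParis.productCoeff a b (a + M - q) f m q (n + (q + 1)) *
        x ^ (n + (q + 1)) = x ^ (q + 1) * (R.eval (-(q : ℂ) - 1) *
          MillerParis.poch (b - a) (q + 1) / MillerParis.poch (a + M - q) (q + 1)) *
        (MillerParis.hypCoeff (1 ::ₘ (a - b + 1) ::ₘ R.roots.map fun γ => γ + ((q : ℂ) + 1 + 1))
          ((a + M + 1) ::ₘ R.roots.map fun γ => γ + ((q : ℂ) + 1)) n * x ^ n) := by
      intro n
      have h3 := MillerParis.eval_mul_prod_roots R (q + 1)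
        (fun γ h => by simpa using hγ' γ h 0) n
      rw [show -((q : ℂ) + 1) = -(q : ℂ) - 1 by ring] at h3
      rw [add_comm n, MillerParis.productCoeff_add f m hM hq hc hab, ← hR, ← h3,
        MillerParis.hypCoeff_roots _ _ _ _ hγ', MillerParis.poch_add (a + M - q),
        show a + M - q + (q + 1 : ℕ) = a + M + 1 by push_cast; ring, pow_add]
      simp only [div_eq_mul_inv, mul_inv]
      ring
    have h4 : ∀ j ∈ Finset.range (q + 1), MillerParis.productCoeff a b (a + M - q) f m q j * x ^ j =
        MillerParis.poch (-(q : ℂ)) j * MillerParis.poch (a - b - q) j /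
          (MillerParis.poch (a + M - q) j * (j.factorial : ℂ)) *
          MillerParis.hatQ a b f m q j * x ^ j := fun j hj => by
      rw [MillerParis.productCoeff_of_le f m hM hq hc hab
        (Nat.lt_succ_iff.mp (Finset.mem_range.mp hj))]
    rw [← MillerParis.hasSum_iff_of_eq h2] at h1
    have h5 := (hasSum_nat_add_iff (f := fun N =>
      MillerParis.productCoeff a b (a + M - q) f m q N * x ^ N) (q + 1)).mp h1
    rw [Finset.sum_congr rfl h4] at h5
    rwa [add_comm (Finset.sum _ _)]
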